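/- \textbf{Setting.} Let $\mathcal S,\mathcal A$ be compact metric spaces (for instance compact subsets of Euclidean spaces), $\mathcal A$ with its Borel $\sigma$-algebra and $\mathcal S$ with a $\sigma$-algebra containing the Borel sets (for instance the Borel $\sigma$-algebra or a completion of it). Let $\mu_S,\mu_A$ be finite measures on $\mathcal S,\mathcal A$ that are strictly positive on nonempty open sets. Consider a Markov decision process with transition probability kernel $P(\cdot\mid s,a)$ such that every $P(\cdot\mid s,a)$ is absolutely continuous with respect to $\mu_S$ and $(s,a)\mapsto P(\cdot\mid s,a)$ is continuous in total variation, with continuous strictly positive reward $R:\mathcal S\times\mathcal A\to\mathbb R$, and with discount factor $\gamma\in(0,1)$. A policy is a probability kernel $\pi(\cdot\mid s)$ from $\mathcal S$ to $\mathcal A$. Its value functions are $$Q^\pi(s,a)=\mathbb E_\pi\Big[\sum_{k\ge 0}\gamma^kR(s_k,a_k)\,\Big|\,s_0=s,a_0=a\Big],\qquad V^\pi(s)=\mathbb E_\pi\Big[\sum_{k\ge 0}\gamma^kR(s_k,a_k)\,\Big|\,s_0=s\Big],$$ where $s_{k+1}\sim P(\cdot\mid s_k,a_k)$ and $a_{k}\sim\pi(\cdot\mid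 s_{k})$ (for $k\ge 1$ in $Q^\pi$ and $k\ge 0$ in $V^\pi$). A jointly measurable $\pi:\mathcal S\times\mathcal A\to[0,\infty)$ with $\int_{\mathcal A}\pi(a|s)\,d\mu_A(a)=1$ for all $s$ is identified with the policy $\pi(\cdot|s)\cdot\mu_A$; for such a density let $$(B\pi)(a|s)=\frac{Q^\pi(s,a)\,\pi(a|s)}{V^\pi(s)},$$ which is again a policy density. Let $[T(Q)](s,a)=R(s,a)+\gamma\int_{\mathcal S}\sup_{a'}Q(s',a')\,P(ds'\mid s,a)$ be Bellman's optimality operator, on bounded measurable $Q$ for which $s\mapsto\sup_{a}Q(s,a)$ is measurable. The function $Q$ is called the optimal action-value function if it is the unique fixed point of $T$; a policy $\pi$ is optimal if $Q^\pi$ is the optimal action-value function; $V$ is the optimal state-value function if $V(s)=\max_\pi V^\pi(s)$ for every $s$, the maximum being over all policies. For $F\subset\mathcal A$, probability measures $P_n$ on $\mathcal A$ are said to converge to $P'$ weakly relative to $F$, written $P_n\to^{w(F)}P'$, if their images converge weakly to the image of $P'$ in the topological quotient of $\mathcal A$ in which $F$ is collapsed to one point. \textbf{Theorem (global convergence of RWR).}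 Let $\pi_0$ be a policy density with $\pi_0(a|s)>0$ for all $s,a$ and with $a\mapsto\pi_0(a|s)$ continuous for every $s$, and let $\pi_n=B(\pi_{n-1})$ for $n\ge 1$, $V_n=V^{\pi_n}$, $Q_n=Q^{\pi_n}$. Then the pointwise limits $V_L=\lim_n V_n$ and $Q_L=\lim_nQ_n$ exist, and they are the optimal state-value and action-value functions. Put $M(s)=\operatorname{argmax}_aQ_L(s,a)$. There is a greedy policy for $Q_L$, that is, a policy $\pi_L$ with $\pi_L(M(s)\mid s)=1$ for all $s$; and for every such $\pi_L$ $$\pi_n(\cdot|s)\cdot\mu_A\;\to^{w(M(s))}\;\pi_L(\cdot|s)\qquad\text{for every } s\in\mathcal S,$$ $\pi_L$ is an optimal policy, $V^{\pi_L}=V_L$ and $Q^{\pi_L}=Q_L$. -/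

import Mathlib

open MeasureTheory ProbabilityTheory Filter Topology

/-- A discounted Markov decision process whose state space `S` and action space `A` are compact
metric spaces, with finite strictly positive reference measures on both, a transition kernel that
is dominated by the reference measure of `S` and continuous in total variation, and a strictly
positive continuous reward. -/
structure CompactMDP (S A : Type*) [MetricSpace S] [CompactSpace S] [MeasurableSpace S]
    [OpensMeasurableSpace S] [MetricSpace A] [CompactSpace A] [MeasurableSpace A]
    [BorelSpace A] where
  /-- reference measure on states -/
  muS : Measure S
  /-- reference measure on actions -/
  muA : Measure A
  finite_muS : IsFiniteMeasure muS
  finite_muA : IsFiniteMeasure muA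
  openPos_muS : muS.IsOpenPosMeasure
  openPos_muA : muA.IsOpenPosMeasure
  /-- transition kernel: `P (s, a)` is the law of the next state -/
  P : Kernel (S × A) S
  markov_P : IsMarkovKernel P
  /-- every `P (s, a)` has a density with respect to `muS` -/
  ac_P : ∀ x, P x ≪ muS
  /-- continuity in total variation -/
  tv_P : ∀ x₀, ∀ ε > 0, ∀ᶠ x in 𝓝 x₀, ∀ E, MeasurableSet E →
    |(P x).real E - (P x₀).real E| ≤ ε
  /-- reward -/
  R : S × A → ℝ
  continuous_R : Continuous R
  R_pos : ∀ x, 0 < R x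
  /-- discount factor -/
  γ : ℝ
  γ_pos : 0 < γ
  γ_lt_one : γ < 1

namespace CompactMDP

variable {S A : Type*} [MetricSpace S] [CompactSpace S] [MeasurableSpace S]
  [OpensMeasurableSpace S] [MetricSpace A] [CompactSpace A] [MeasurableSpace A] [BorelSpace A]

/-- A (stochastic) policy: a probability kernel from states to actions. -/
structure Policy (M : CompactMDP S A) where
  ker : Kernel S A
  markov : IsMarkovKernel ker

attribute [instance] CompactMDP.finite_muS CompactMDP.finite_muA CompactMDP.openPos_muS
  CompactMDP.openPos_muA CompactMDP.markov_P Policy.markov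

variable (M : CompactMDP S A)

/-! ### Trajectories, returns and value functions -/

/-- One step of the state-action chain under `π`: from `(s, a)` draw `s'` from `P (s, a)` and then
`a'` from `π s'`. -/
noncomputable def stepKernel (π : M.Policy) : Kernel (S × A) (S × A) :=
  (Kernel.id ×ₖ π.ker) ∘ₖ M.P

instance (π : M.Policy) : IsMarkovKernel (M.stepKernel π) := by
  unfold stepKernel; infer_instance

/-- The step kernel, seen as depending on the whole past of the trajectory through its last
state-action pair only. -/
noncomputable def histKernel (π : M.Policy) (n : ℕ) :
    Kernel ((i : Finset.Iic n) → (fun _ : ℕ => S × A) i) (S × A) :=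
  (M.stepKernel π).comap (fun h => h ⟨n, Finset.mem_Iic.2 le_rfl⟩) (measurable_pi_apply _)

instance (π : M.Policy) (n : ℕ) : IsMarkovKernel (M.histKernel π n) := by
  unfold histKernel; infer_instance

/-- Law of the trajectory `(s₀, a₀), (s₁, a₁), …` under `π`, given `(s₀, a₀)`. -/
noncomputable def trajQ (π : M.Policy) : Kernel (S × A) (ℕ → S × A) :=
  (Kernel.traj (X := fun _ => S × A) (M.histKernel π) 0).comap (fun x _ => x)
    (measurable_pi_lambda _ fun _ => measurable_id)

instance (π : M.Policy) : IsMarkovKernel (M.trajQ π) := by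
  unfold trajQ; infer_instance

/-- Law of the trajectory under `π`, given `s₀` (so that `a₀` is drawn from `π s₀`). -/
noncomputable def trajV (π : M.Policy) : Kernel S (ℕ → S × A) :=
  M.trajQ π ∘ₖ (Kernel.id ×ₖ π.ker)

instance (π : M.Policy) : IsMarkovKernel (M.trajV π) := by
  unfold trajV; infer_instance

/-- The discounted return of a trajectory. -/
noncomputable def ret (ω : ℕ → S × A) : ℝ := ∑' k, M.γ ^ k * M.R (ω k)

/-- Action-value function `Q^π (s, a)`: the expected return given `s₀ = s`, `a₀ = a`. -/
noncomputable def Q (π : M.Policy) (x : S × A) : ℝ := ∫ ω, M.ret ω ∂(M.trajQ π x)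

/-- State-value function `V^π s`: the expected return given `s₀ = s`. -/
noncomputable def V (π : M.Policy) (s : S) : ℝ := ∫ ω, M.ret ω ∂(M.trajV π s)

/-! ### Facts needed for the update operator to be well defined -/

theorem measurable_R : Measurable M.R := M.continuous_R.measurable

theorem exists_R_le : ∃ C, 0 < C ∧ ∀ x, M.R x ≤ C := by
  obtain ⟨C, hC⟩ := isCompact_univ.exists_bound_of_continuousOn (M.continuous_R.continuousOn)
  refine ⟨max C 1, by positivity, fun x => ?_⟩
  exact (le_abs_self _).trans ((hC x trivial).trans (le_max_left _ _))

theorem summable_ret (ω : ℕ → S × A) : Summable fun k => M.γ ^ k * M.R (ω k) := by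
  obtain ⟨C, hC, h⟩ := M.exists_R_le
  refine Summable.of_nonneg_of_le
    (fun k => mul_nonneg (pow_nonneg M.γ_pos.le _) (M.R_pos _).le)
    (fun k => mul_le_mul_of_nonneg_left (h _) (pow_nonneg M.γ_pos.le _))
    ((summable_geometric_of_lt_one M.γ_pos.le M.γ_lt_one).mul_right C)

theorem ret_pos (ω : ℕ → S × A) : 0 < M.ret ω :=
  (M.summable_ret ω).tsum_pos
    (fun k => mul_nonneg (pow_nonneg M.γ_pos.le _) (M.R_pos _).le) 0
    (mul_pos (pow_pos M.γ_pos _) (M.R_pos _))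

theorem exists_ret_le : ∃ C, ∀ ω, M.ret ω ≤ C := by
  obtain ⟨C, hC, h⟩ := M.exists_R_le
  exact ⟨_, fun ω => (M.summable_ret ω).tsum_le_tsum
    (fun k => mul_le_mul_of_nonneg_left (h _) (pow_nonneg M.γ_pos.le _))
    ((summable_geometric_of_lt_one M.γ_pos.le M.γ_lt_one).mul_right C)⟩

theorem measurable_ret : Measurable M.ret := by
  refine measurable_of_tendsto_metrizable
    (f := fun n ω => ∑ k ∈ Finset.range n, M.γ ^ k * M.R (ω k)) (fun n => ?_) ?_
  · exact Finset.measurable_sum _ fun _ _ =>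
      (M.measurable_R.comp (measurable_pi_apply _)).const_mul _
  · exact tendsto_pi_nhds.2 fun ω => (M.summable_ret ω).hasSum.tendsto_sum_nat

theorem integrable_ret (μ : Measure (ℕ → S × A)) [IsProbabilityMeasure μ] :
    Integrable M.ret μ := by
  obtain ⟨C, hC⟩ := M.exists_ret_le
  refine Integrable.of_bound M.measurable_ret.aestronglyMeasurable C (ae_of_all _ fun ω => ?_)
  rw [Real.norm_of_nonneg (M.ret_pos ω).le]
  exact hC ω

theorem integral_ret_pos (μ : Measure (ℕ → S × A)) [IsProbabilityMeasure μ] :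
    0 < ∫ ω, M.ret ω ∂μ := by
  rw [integral_pos_iff_support_of_nonneg (fun ω => (M.ret_pos ω).le) (M.integrable_ret μ)]
  have : Function.support M.ret = Set.univ :=
    Set.eq_univ_of_forall fun ω => (M.ret_pos ω).ne'
  simp [this]

theorem Q_pos (π : M.Policy) (x : S × A) : 0 < M.Q π x := M.integral_ret_pos _

theorem V_pos (π : M.Policy) (s : S) : 0 < M.V π s := M.integral_ret_pos _

theorem measurable_Q (π : M.Policy) : Measurable (M.Q π) :=
  (M.measurable_ret.stronglyMeasurable.integral_kernel (κ := M.trajQ π)).measurable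

theorem measurable_V (π : M.Policy) : Measurable (M.V π) :=
  (M.measurable_ret.stronglyMeasurable.integral_kernel (κ := M.trajV π)).measurable

theorem V_eq_integral_Q (π : M.Policy) (s : S) : M.V π s = ∫ a, M.Q π (s, a) ∂(π.ker s) := by
  have h1 : M.V π s = ∫ x, M.Q π x ∂((Kernel.id ×ₖ π.ker) s) :=
    Kernel.integral_comp (M.integrable_ret _)
  rw [h1, Kernel.prod_apply, Kernel.id_apply, Measure.dirac_prod,
    integral_map (by fun_prop) (M.measurable_Q π).aestronglyMeasurable]

/-! ### Policies given by densities and the update operator -/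

/-- A policy given by a conditional density `dens s a` of actions with respect to `muA`. -/
structure DensityPolicy where
  dens : S → A → ℝ
  measurable_dens : Measurable (Function.uncurry dens)
  nonneg : ∀ s a, 0 ≤ dens s a
  lintegral_eq_one : ∀ s, ∫⁻ a, ENNReal.ofReal (dens s a) ∂M.muA = 1

variable {M}

/-- The kernel `s ↦ π(·|s) · muA`. -/
noncomputable def DensityPolicy.toPolicy (π : M.DensityPolicy) : M.Policy where
  ker := (Kernel.const S M.muA).withDensity fun s a => ENNReal.ofReal (π.dens s a)
  markov := ⟨fun s => ⟨by
    rw [Kernel.withDensity_apply _ π.measurable_dens.ennreal_ofReal, Kernel.const_apply,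
      withDensity_apply _ MeasurableSet.univ, Measure.restrict_univ, π.lintegral_eq_one]⟩⟩

theorem DensityPolicy.toPolicy_apply (π : M.DensityPolicy) (s : S) :
    π.toPolicy.ker s = M.muA.withDensity fun a => ENNReal.ofReal (π.dens s a) := by
  change (Kernel.const S M.muA).withDensity _ s = _
  rw [Kernel.withDensity_apply _ π.measurable_dens.ennreal_ofReal, Kernel.const_apply]

variable (M)

/-- The reward-weighted-regression update `(B π)(a|s) = Q^π(s, a) π(a|s) / V^π(s)`. -/
noncomputable def B (π : M.DensityPolicy) : M.DensityPolicy where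
  dens s a := M.Q π.toPolicy (s, a) * π.dens s a / M.V π.toPolicy s
  measurable_dens := ((M.measurable_Q _).mul π.measurable_dens).div
    ((M.measurable_V _).comp measurable_fst)
  nonneg s a := div_nonneg (mul_nonneg (M.Q_pos _ _).le (π.nonneg s a)) (M.V_pos _ _).le
  lintegral_eq_one s := by
    have hm : Measurable fun a => π.dens s a := π.measurable_dens.comp measurable_prodMk_left
    have hQ : Measurable fun a => M.Q π.toPolicy (s, a) :=
      (M.measurable_Q _).comp measurable_prodMk_left
    have hV := M.V_pos π.toPolicy s
    have e : ∀ a, ENNReal.ofReal (M.Q π.toPolicy (s, a) * π.dens s a / M.V π.toPolicy s) =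
        ENNReal.ofReal (π.dens s a) * ENNReal.ofReal (M.Q π.toPolicy (s, a))
          * (ENNReal.ofReal (M.V π.toPolicy s))⁻¹ := by
      intro a
      rw [ENNReal.ofReal_div_of_pos hV, mul_comm (M.Q _ _), ENNReal.ofReal_mul (π.nonneg s a),
        div_eq_mul_inv]
    simp_rw [e]
    rw [lintegral_mul_const (ENNReal.ofReal (M.V π.toPolicy s))⁻¹
      (f := fun a => ENNReal.ofReal (π.dens s a) * ENNReal.ofReal (M.Q π.toPolicy (s, a)))
      (hm.ennreal_ofReal.mul hQ.ennreal_ofReal)]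
    have h2 : ∫⁻ a, ENNReal.ofReal (π.dens s a) * ENNReal.ofReal (M.Q π.toPolicy (s, a)) ∂M.muA
        = ∫⁻ a, ENNReal.ofReal (M.Q π.toPolicy (s, a)) ∂(π.toPolicy.ker s) := by
      rw [π.toPolicy_apply, lintegral_withDensity_eq_lintegral_mul _ hm.ennreal_ofReal
        hQ.ennreal_ofReal]
      rfl
    obtain ⟨C, hC⟩ := M.exists_ret_le
    have hint : Integrable (fun a => M.Q π.toPolicy (s, a)) (π.toPolicy.ker s) := by
      refine Integrable.of_bound hQ.aestronglyMeasurable C (ae_of_all _ fun a => ?_)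
      rw [Real.norm_of_nonneg (M.Q_pos _ _).le]
      calc M.Q π.toPolicy (s, a) ≤ ∫ _, C ∂(M.trajQ π.toPolicy (s, a)) :=
            integral_mono (M.integrable_ret _) (integrable_const _) hC
        _ = C := by simp
    rw [h2, ← ofReal_integral_eq_lintegral_ofReal hint (ae_of_all _ fun a => (M.Q_pos _ _).le),
      ← M.V_eq_integral_Q]
    exact ENNReal.mul_inv_cancel (by simpa using hV) ENNReal.ofReal_ne_top

/-! ### Greedy policies and optimality -/

/-- The set of maximisers of `q (s, ·)`. -/
def argmaxSet (q : S × A → ℝ) (s : S) : Set A := {a | ∀ a', q (s, a') ≤ q (s, a)}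

/-- `π` is greedy for `q`: for every state, `π(·|s)` gives full mass to the maximisers. -/
def IsGreedy (q : S × A → ℝ) (π : M.Policy) : Prop := ∀ s, π.ker s (argmaxSet q s) = 1

/-- Bellman's optimality operator. -/
noncomputable def T (q : S × A → ℝ) (x : S × A) : ℝ :=
  M.R x + M.γ * ∫ s', (⨆ a', q (s', a')) ∂(M.P x)

/-- `q` is a fixed point of Bellman's optimality operator, among the bounded measurable functions
with measurable maximum over actions (those on which the operator makes sense). -/
def IsBellmanFixedPoint (q : S × A → ℝ) : Prop :=
  Measurable q ∧ (∃ C, ∀ x, |q x| ≤ C) ∧ (Measurable fun s => ⨆ a, q (s, a)) ∧ M.T q = q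

/-- `q` is the optimal action-value function: the unique fixed point of Bellman's optimality
operator. -/
def IsOptimalActionValue (q : S × A → ℝ) : Prop :=
  M.IsBellmanFixedPoint q ∧ ∀ q', M.IsBellmanFixedPoint q' → q' = q

/-- `v` is the optimal state-value function: in every state it is the largest value that a policy
can have there. -/
def IsOptimalStateValue (v : S → ℝ) : Prop :=
  ∀ s, IsGreatest (Set.range fun π : M.Policy => M.V π s) (v s)

/-- A policy is optimal if its action-value function is. -/
def IsOptimalPolicy (π : M.Policy) : Prop := M.IsOptimalActionValue (M.Q π)

end CompactMDP

/-! ### Weak convergence relative to a set -/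

/-- The equivalence relation that identifies all points of `F` with each other. -/
def collapseSetoid {X : Type*} (F : Set X) : Setoid X where
  r x y := x = y ∨ (x ∈ F ∧ y ∈ F)
  iseqv := ⟨fun _ => Or.inl rfl, by rintro x y (h | h); exacts [Or.inl h.symm, Or.inr h.symm], by
    rintro x y z (rfl | h) (rfl | h')
    exacts [Or.inl rfl, Or.inr h', Or.inr h, Or.inr ⟨h.1, h'.2⟩]⟩

/-- The quotient of `X` in which `F` is collapsed to a point, with the quotient topology and its
Borel `σ`-algebra. -/
def Collapse {X : Type*} (F : Set X) : Type _ := Quotient (collapseSetoid F)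

namespace Collapse

variable {X : Type*} [TopologicalSpace X] (F : Set X)

instance : TopologicalSpace (Collapse F) :=
  inferInstanceAs (TopologicalSpace (Quotient (collapseSetoid F)))

instance : MeasurableSpace (Collapse F) := borel _

instance : BorelSpace (Collapse F) := ⟨rfl⟩

/-- The quotient map. -/
def mk (x : X) : Collapse F := Quotient.mk (collapseSetoid F) x

theorem continuous_mk : Continuous (mk F) := continuous_quot_mk

theorem measurable_mk [MeasurableSpace X] [OpensMeasurableSpace X] : Measurable (mk F) :=
  (continuous_mk F).measurable

end Collapse

/-- Weak convergence of probability measures relative to `F`: the images in the quotient that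
collapses `F` to a point converge weakly. -/
def TendstoWeaklyRel {X : Type*} [TopologicalSpace X] [MeasurableSpace X]
    [OpensMeasurableSpace X] (F : Set X) (μ : ℕ → ProbabilityMeasure X)
    (μ' : ProbabilityMeasure X) : Prop :=
  Tendsto (fun n => (μ n).map (Collapse.measurable_mk F).aemeasurable) atTop
    (𝓝 (μ'.map (Collapse.measurable_mk F).aemeasurable))

/-- The action distribution of a policy in state `s`, as a probability measure. -/
noncomputable def CompactMDP.Policy.law {S A : Type*} [MetricSpace S] [CompactSpace S]
    [MeasurableSpace S] [OpensMeasurableSpace S] [MetricSpace A] [CompactSpace A]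
    [MeasurableSpace A] [BorelSpace A] {M : CompactMDP S A} (π : M.Policy) (s : S) :
    ProbabilityMeasure A :=
  ⟨π.ker s, inferInstance⟩

/-! Write `L v = R + γ P v` for the one-step lookahead; the Bellman equation reads `Q^π = L V^π`. An
update tilts the action law by `Q/V`. The mean of `Q^π(s,·)` under the tilted law exceeds `V^π(s)`
by the variance of `Q^π(s,·)` divided by `V^π(s)`. So `V^π` is a subsolution for the new policy, and
the contraction factor `γ` turns this into policy improvement (`V_le_V_B`). Hence `V_n` and `Q_n`
increase, to some `v` and to `q = L v`.

The heart is `v(s) = sup_a q(s,a)`. Continuity in total variation makes each `Q_n` and `q`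
continuous. If `q(s,a) > v(s)`, some open neighbourhood of `a` has `Q_n > c > v(s)` for all large
`n`. Its mass is positive, because the densities are positive and `muA` charges open sets, and each
update multiplies it by at least `c / v(s) > 1`, which is absurd (`lookahead_limit_le`). The
converse holds because `V_n` is an average of `Q_n ≤ q`. So `(v, q)` solves the Bellman optimality
equation (`IsOptimalPair`), and comparison principles give uniqueness, optimality, and the values of
greedy policies.

The same multiplication shrinks compact sets of suboptimal actions geometrically
(`tendsto_real_zero`). A continuous function on the quotient is constant on the argmax set, so this
is weak convergence relative to that set. Greedy policies come from a measurable selection of the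
closed argmax relation. -/

namespace CompactMDP

variable {S A : Type*} [MetricSpace S] [CompactSpace S] [MeasurableSpace S]
  [OpensMeasurableSpace S] [MetricSpace A] [CompactSpace A] [MeasurableSpace A] [BorelSpace A]
  (M : CompactMDP S A)

/-! ### Marginals of the trajectory and the Bellman equation -/

/-- Law of the `k`-th state-action pair under `π`, given the initial pair. -/
noncomputable def marginal (π : M.Policy) (k : ℕ) : Kernel (S × A) (S × A) :=
  (M.trajQ π).map fun ω => ω k

instance (π : M.Policy) (k : ℕ) : IsMarkovKernel (M.marginal π k) :=
  Kernel.IsMarkovKernel.map _ (measurable_pi_apply k)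

theorem marginal_zero (π : M.Policy) : M.marginal π 0 = Kernel.id := by
  ext x : 1
  rw [marginal, Kernel.map_apply _ (measurable_pi_apply 0), trajQ, Kernel.comap_apply,
    Kernel.id_apply]
  have h := Kernel.traj_map_frestrictLe_apply (X := fun _ => S × A) (κ := M.histKernel π) 0 0
    (fun _ => x)
  rw [Kernel.partialTraj_self, Kernel.id_apply] at h
  have h2 := congrArg (fun μ => μ.map fun f : (i : Finset.Iic 0) → S × A =>
    f ⟨0, Finset.mem_Iic.2 le_rfl⟩) h
  rw [Measure.map_map (measurable_pi_apply _) (by fun_prop)] at h2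
  exact h2.trans (Measure.map_dirac' (measurable_pi_apply _) _)

/-- The Markov property: `histKernel` sees the past only through its last coordinate, so the
trajectory's conditional law of the next pair depends on the `k`-th marginal alone. -/
theorem marginal_succ (π : M.Policy) (k : ℕ) :
    M.marginal π (k + 1) = M.stepKernel π ∘ₖ M.marginal π k := by
  have hm : Measurable fun f : (i : Finset.Iic k) → (fun _ : ℕ => S × A) i =>
      f ⟨k, Finset.mem_Iic.2 le_rfl⟩ := measurable_pi_apply _
  have h1 : (Kernel.traj (X := fun _ => S × A) (M.histKernel π) 0).map (fun ω => ω (k + 1)) =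
      M.stepKernel π ∘ₖ (Kernel.traj (X := fun _ => S × A) (M.histKernel π) 0).map
        (fun ω => ω k) := by
    rw [← Kernel.traj_comp_partialTraj (Nat.zero_le k), Kernel.map_comp,
      Kernel.map_traj_succ_self, Kernel.traj_comp_partialTraj (Nat.zero_le k),
      ← Kernel.traj_map_frestrictLe, histKernel, ← Kernel.comp_map _ _ hm,
      ← Kernel.map_comp_right _ (by fun_prop) hm]
    rfl
  ext x : 1
  have h2 := congrArg (fun η => η fun _ => x) h1
  simp only at h2
  rw [marginal, Kernel.map_apply _ (measurable_pi_apply _), trajQ, Kernel.comap_apply,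
    ← Kernel.map_apply _ (measurable_pi_apply _), h2, Kernel.comp_apply, Kernel.comp_apply,
    Kernel.map_apply _ (measurable_pi_apply _), marginal,
    Kernel.map_apply _ (measurable_pi_apply _), trajQ, Kernel.comap_apply]

/-- The marginals are powers of the step kernel, which commute with it. This form splits off the
first step, as the Bellman equation needs. -/
theorem marginal_succ' (π : M.Policy) (k : ℕ) :
    M.marginal π (k + 1) = M.marginal π k ∘ₖ M.stepKernel π := by
  induction k with
  | zero => rw [marginal_succ, marginal_zero, Kernel.id_comp, Kernel.comp_id]
  | succ k ih => rw [marginal_succ, ih, ← Kernel.comp_assoc, ← marginal_succ, ih]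

/-! ### Discounted expected rewards and the Bellman equation -/

theorem integrable_R (μ : Measure (S × A)) [IsFiniteMeasure μ] : Integrable M.R μ := by
  obtain ⟨C, -, hC⟩ := M.exists_R_le
  refine Integrable.of_bound M.measurable_R.aestronglyMeasurable C (ae_of_all _ fun x => ?_)
  rw [Real.norm_of_nonneg (M.R_pos x).le]
  exact hC x

theorem integral_marginal_nonneg (π : M.Policy) (k : ℕ) (x : S × A) :
    0 ≤ ∫ y, M.R y ∂(M.marginal π k x) :=
  integral_nonneg fun y => (M.R_pos y).le

theorem integral_marginal_le (π : M.Policy) (k : ℕ) (x : S × A) {C : ℝ} (hC : ∀ x, M.R x ≤ C) :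
    ∫ y, M.R y ∂(M.marginal π k x) ≤ C := by
  calc _ ≤ ∫ _, C ∂(M.marginal π k x) :=
        integral_mono (M.integrable_R _) (integrable_const _) hC
    _ = C := by simp

theorem measurable_integral_marginal (π : M.Policy) (k : ℕ) :
    Measurable fun x => ∫ y, M.R y ∂(M.marginal π k x) :=
  (M.measurable_R.stronglyMeasurable.integral_kernel (κ := M.marginal π k)).measurable

theorem integrable_integral_marginal (π : M.Policy) (k : ℕ) (μ : Measure (S × A))
    [IsFiniteMeasure μ] : Integrable (fun x => ∫ y, M.R y ∂(M.marginal π k x)) μ := by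
  obtain ⟨C, -, hC⟩ := M.exists_R_le
  refine Integrable.of_bound (M.measurable_integral_marginal π k).aestronglyMeasurable C
    (ae_of_all _ fun x => ?_)
  rw [Real.norm_of_nonneg (M.integral_marginal_nonneg π k x)]
  exact M.integral_marginal_le π k x hC

theorem summable_discounted {u : ℕ → ℝ} {C : ℝ} (h0 : ∀ k, 0 ≤ u k) (hC : ∀ k, u k ≤ C) :
    Summable fun k => M.γ ^ k * u k :=
  Summable.of_nonneg_of_le (fun k => mul_nonneg (pow_nonneg M.γ_pos.le _) (h0 k))
    (fun k => mul_le_mul_of_nonneg_left (hC k) (pow_nonneg M.γ_pos.le _))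
    ((summable_geometric_of_lt_one M.γ_pos.le M.γ_lt_one).mul_right C)

theorem hasSum_Q (π : M.Policy) (x : S × A) :
    HasSum (fun k => M.γ ^ k * ∫ y, M.R y ∂(M.marginal π k x)) (M.Q π x) := by
  obtain ⟨C, -, hC⟩ := M.exists_R_le
  have e : ∀ k, ∫ y, M.R y ∂(M.marginal π k x) = ∫ ω, M.R (ω k) ∂(M.trajQ π x) := by
    intro k
    rw [marginal, Kernel.map_apply _ (measurable_pi_apply k),
      integral_map (measurable_pi_apply k).aemeasurable M.measurable_R.aestronglyMeasurable]
  have hint : ∀ k, Integrable (fun ω : ℕ → S × A => M.γ ^ k * M.R (ω k)) (M.trajQ π x) := by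
    intro k
    refine Integrable.const_mul (Integrable.of_bound
      (M.measurable_R.comp (measurable_pi_apply k)).aestronglyMeasurable C
      (ae_of_all _ fun ω => ?_)) _
    rw [Function.comp_apply, Real.norm_of_nonneg (M.R_pos _).le]
    exact hC _
  have h := hasSum_integral_of_summable_integral_norm hint (by
    have : ∀ k (ω : ℕ → S × A), ‖M.γ ^ k * M.R (ω k)‖ = M.γ ^ k * M.R (ω k) := fun k ω =>
      Real.norm_of_nonneg (mul_nonneg (pow_nonneg M.γ_pos.le _) (M.R_pos _).le)
    simp_rw [this, integral_const_mul, ← e]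
    exact M.summable_discounted (fun k => M.integral_marginal_nonneg π k x)
      (fun k => M.integral_marginal_le π k x hC))
  simp_rw [integral_const_mul, ← e] at h
  exact h

theorem exists_value_le : ∃ C, (∀ (π : M.Policy) x, M.Q π x ≤ C) ∧
    ∀ (π : M.Policy) s, M.V π s ≤ C := by
  obtain ⟨C, hC⟩ := M.exists_ret_le
  have key : ∀ (μ : Measure (ℕ → S × A)) [IsProbabilityMeasure μ], ∫ ω, M.ret ω ∂μ ≤ C := by
    intro μ _
    calc ∫ ω, M.ret ω ∂μ ≤ ∫ _, C ∂μ :=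
          integral_mono (M.integrable_ret _) (integrable_const _) hC
      _ = C := by simp
  exact ⟨C, fun π x => key _, fun π s => key _⟩

theorem integrable_Q (π : M.Policy) (μ : Measure (S × A)) [IsFiniteMeasure μ] :
    Integrable (M.Q π) μ := by
  obtain ⟨C, hC, -⟩ := M.exists_value_le
  refine Integrable.of_bound (M.measurable_Q π).aestronglyMeasurable C (ae_of_all _ fun x => ?_)
  rw [Real.norm_of_nonneg (M.Q_pos _ _).le]
  exact hC _ _

theorem integral_stepKernel_Q (π : M.Policy) (x : S × A) :
    ∫ y, M.Q π y ∂(M.stepKernel π x) = ∫ s, M.V π s ∂(M.P x) := by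
  rw [stepKernel, Kernel.integral_comp (M.integrable_Q π _)]
  refine integral_congr_ae (ae_of_all _ fun s => ?_)
  exact (Kernel.integral_comp (M.integrable_ret _)).symm

/-- One-step lookahead: the action values that result from the state values `v`. -/
noncomputable def lookahead (v : S → ℝ) (x : S × A) : ℝ := M.R x + M.γ * ∫ s, v s ∂(M.P x)

/-- The Bellman equation. -/
theorem Q_eq_lookahead (π : M.Policy) : M.Q π = M.lookahead (M.V π) := by
  ext x
  obtain ⟨C, -, hC⟩ := M.exists_R_le
  have hstep : ∀ k, ∫ z, M.R z ∂(M.marginal π (k + 1) x) =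
      ∫ y, ∫ z, M.R z ∂(M.marginal π k y) ∂(M.stepKernel π x) := by
    intro k
    rw [marginal_succ', Kernel.integral_comp (M.integrable_R _)]
  -- Averaging the series for `Q` over the first step turns its `k`-th reward into the `(k+1)`-st
  -- reward seen from `x`; only the term of time 0 and one factor `γ` remain to be split off.
  have h := hasSum_integral_of_summable_integral_norm
    (F := fun k y => M.γ ^ k * ∫ z, M.R z ∂(M.marginal π k y)) (μ := M.stepKernel π x)
    (fun k => (M.integrable_integral_marginal π k _).const_mul _) (by
      have : ∀ k y, ‖M.γ ^ k * ∫ z, M.R z ∂(M.marginal π k y)‖ =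
          M.γ ^ k * ∫ z, M.R z ∂(M.marginal π k y) := fun k y =>
        Real.norm_of_nonneg
          (mul_nonneg (pow_nonneg M.γ_pos.le _) (M.integral_marginal_nonneg π k y))
      simp_rw [this, integral_const_mul, ← hstep]
      exact M.summable_discounted (fun k => M.integral_marginal_nonneg π (k + 1) x)
        (fun k => M.integral_marginal_le π (k + 1) x hC))
  simp_rw [(M.hasSum_Q π _).tsum_eq, integral_const_mul, ← hstep] at h
  have h0 := (M.hasSum_Q π x).tsum_eq
  rw [(M.hasSum_Q π x).summable.tsum_eq_zero_add] at h0
  rw [← h0, lookahead, ← M.integral_stepKernel_Q, ← h.tsum_eq, ← tsum_mul_left, marginal_zero,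
    Kernel.id_apply, integral_dirac' _ _ M.measurable_R.stronglyMeasurable, pow_zero, one_mul]
  simp_rw [pow_succ']
  simp only [mul_assoc]

end CompactMDP

namespace CompactMDP

variable {S A : Type*} [MetricSpace S] [CompactSpace S] [MeasurableSpace S]
  [OpensMeasurableSpace S] [MetricSpace A] [CompactSpace A] [MeasurableSpace A] [BorelSpace A]
  (M : CompactMDP S A)

/-! ### The one-step lookahead -/

theorem lookahead_sub {v w : S → ℝ} {x : S × A} (hv : Integrable v (M.P x))
    (hw : Integrable w (M.P x)) :
    M.lookahead v x - M.lookahead w x = M.γ * ∫ s, (v s - w s) ∂(M.P x) := by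
  rw [integral_sub hv hw, lookahead, lookahead]
  ring

theorem lookahead_sub_le {v w : S → ℝ} {x : S × A} (hv : Integrable v (M.P x))
    (hw : Integrable w (M.P x)) {D : ℝ} (hD : ∀ s, v s - w s ≤ D) :
    M.lookahead v x - M.lookahead w x ≤ M.γ * D := by
  rw [M.lookahead_sub hv hw]
  refine mul_le_mul_of_nonneg_left ?_ M.γ_pos.le
  calc ∫ s, (v s - w s) ∂(M.P x) ≤ ∫ _, D ∂(M.P x) :=
        integral_mono (hv.sub hw) (integrable_const _) hD
    _ = D := by simp

theorem measurable_lookahead {v : S → ℝ} (hv : Measurable v) : Measurable (M.lookahead v) :=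
  M.measurable_R.add
    ((hv.stronglyMeasurable.integral_kernel (κ := M.P)).measurable.const_mul _)

theorem integrable_of_bounded {X : Type*} [MeasurableSpace X] {f : X → ℝ} (hf : Measurable f)
    {C : ℝ} (hC : ∀ x, |f x| ≤ C) (μ : Measure X) [IsFiniteMeasure μ] : Integrable f μ :=
  Integrable.of_bound hf.aestronglyMeasurable C (ae_of_all _ hC)

theorem exists_abs_lookahead_le {v : S → ℝ} {C : ℝ} (hC : ∀ s, |v s| ≤ C) :
    ∃ C', ∀ x, |M.lookahead v x| ≤ C' := by
  obtain ⟨K, -, hK⟩ := M.exists_R_le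
  refine ⟨K + M.γ * C, fun x => ?_⟩
  have h : |∫ s, v s ∂(M.P x)| ≤ C := by
    simpa using norm_integral_le_of_norm_le_const (μ := M.P x) (f := v) (C := C) (ae_of_all _ hC)
  calc |M.lookahead v x| ≤ |M.R x| + |M.γ * ∫ s, v s ∂(M.P x)| := abs_add_le _ _
    _ ≤ K + M.γ * C := by
      rw [abs_of_pos (M.R_pos x), abs_mul, abs_of_pos M.γ_pos]
      exact add_le_add (hK x) (mul_le_mul_of_nonneg_left h M.γ_pos.le)

/-- Continuity in total variation makes the lookahead of any bounded measurable function
continuous. -/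
theorem continuous_lookahead {v : S → ℝ} (hv : Measurable v) (h0 : ∀ s, 0 ≤ v s) {C : ℝ}
    (hC : ∀ s, v s ≤ C) : Continuous (M.lookahead v) := by
  refine M.continuous_R.add (continuous_const.mul ?_)
  have hint : ∀ x, Integrable v (M.P x) := fun x =>
    integrable_of_bounded hv (fun s => by rw [abs_of_nonneg (h0 s)]; exact hC s) _
  -- Layer cake: total variation controls the mass of each superlevel set, so `v` need not be
  -- continuous.
  have e : (fun x => ∫ s, v s ∂(M.P x)) =
      fun x => ∫ t in Set.Ioc 0 C, (M.P x).real {s | t ≤ v s} := by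
    ext x
    exact (hint x).integral_eq_integral_Ioc_meas_le (ae_of_all _ h0) (ae_of_all _ hC)
  rw [e]
  refine continuous_of_dominated (bound := fun _ => 1) (fun x => ?_)
    (fun x => ae_of_all _ fun t => ?_) (integrable_const _) (ae_of_all _ fun t => ?_)
  · refine (Antitone.measurable fun a b hab => ?_).aestronglyMeasurable
    exact measureReal_mono fun s hs => le_trans hab hs
  · rw [Real.norm_of_nonneg measureReal_nonneg]
    exact measureReal_le_one
  · refine continuous_iff_continuousAt.2 fun x₀ => Metric.tendsto_nhds.2 fun ε hε => ?_
    filter_upwards [M.tv_P x₀ (ε / 2) (half_pos hε)] with x hx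
    rw [Real.dist_eq]
    exact (hx _ (measurableSet_le measurable_const hv)).trans_lt (half_lt_self hε)

theorem tendsto_lookahead {v : ℕ → S → ℝ} {w : S → ℝ} (hv : ∀ n, Measurable (v n)) {C : ℝ}
    (hC : ∀ n s, |v n s| ≤ C) (h : ∀ s, Tendsto (fun n => v n s) atTop (𝓝 (w s))) (x : S × A) :
    Tendsto (fun n => M.lookahead (v n) x) atTop (𝓝 (M.lookahead w x)) :=
  ((tendsto_integral_of_dominated_convergence (fun _ => C)
    (fun n => (hv n).aestronglyMeasurable) (integrable_const _)
    (fun n => ae_of_all _ (hC n)) (ae_of_all _ h)).const_mul _).const_add _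

/-! ### Comparison principles -/

/-- Any nonnegative upper bound can be improved by the factor `γ`; iterating drives it to 0. Applied
to differences, this one-sided contraction gives every comparison below without sup norms. -/
theorem nonpos_of_contraction {X : Type*} {f : X → ℝ} {C : ℝ} (hC : ∀ x, f x ≤ C)
    (h : ∀ D, 0 ≤ D → (∀ x, f x ≤ D) → ∀ x, f x ≤ M.γ * D) (x : X) : f x ≤ 0 := by
  have key : ∀ n : ℕ, ∀ x, f x ≤ M.γ ^ n * max C 0 := by
    intro n
    induction n with
    | zero => simpa using fun x => Or.inl (hC x)
    | succ n ih =>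
      intro x
      rw [pow_succ', mul_assoc]
      exact h _ (mul_nonneg (pow_nonneg M.γ_pos.le _) (le_max_right _ _)) ih x
  have hl : Tendsto (fun n : ℕ => M.γ ^ n * max C 0) atTop (𝓝 0) := by
    simpa using (tendsto_pow_atTop_nhds_zero_of_lt_one M.γ_pos.le M.γ_lt_one).mul_const (max C 0)
  exact ge_of_tendsto' hl fun n => key n x

theorem V_abs_le : ∃ C, ∀ (π : M.Policy) s, |M.V π s| ≤ C := by
  obtain ⟨C, -, hC⟩ := M.exists_value_le
  exact ⟨C, fun π s => by rw [abs_of_pos (M.V_pos π s)]; exact hC π s⟩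

theorem V_eq_integral_lookahead (π : M.Policy) (s : S) :
    M.V π s = ∫ a, M.lookahead (M.V π) (s, a) ∂(π.ker s) := by
  rw [← M.Q_eq_lookahead, M.V_eq_integral_Q]

theorem integrable_lookahead {v : S → ℝ} (hv : Measurable v) {C : ℝ} (hC : ∀ s, |v s| ≤ C)
    (s : S) (μ : Measure A) [IsFiniteMeasure μ] :
    Integrable (fun a => M.lookahead v (s, a)) μ := by
  obtain ⟨C', hC'⟩ := M.exists_abs_lookahead_le hC
  exact integrable_of_bounded ((M.measurable_lookahead hv).comp measurable_prodMk_left)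
    (fun a => hC' (s, a)) μ

theorem integral_le_of_le {X : Type*} [MeasurableSpace X] (μ : Measure X) [IsProbabilityMeasure μ]
    {f g : X → ℝ} (hf : Integrable f μ) (hg : Integrable g μ) {D : ℝ} (h : ∀ x, f x - g x ≤ D) :
    ∫ x, f x ∂μ - ∫ x, g x ∂μ ≤ D := by
  rw [← integral_sub hf hg]
  calc ∫ x, (f x - g x) ∂μ ≤ ∫ _, D ∂μ := integral_mono (hf.sub hg) (integrable_const _) h
    _ = D := by simp

/-- A bounded subsolution of the Bellman equation of `π` lies below `V^π`. -/
theorem le_V_of_le (π : M.Policy) {v : S → ℝ} (hv : Measurable v) {C : ℝ} (hC : ∀ s, |v s| ≤ C)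
    (h : ∀ s, v s ≤ ∫ a, M.lookahead v (s, a) ∂(π.ker s)) (s : S) : v s ≤ M.V π s := by
  obtain ⟨K, hK⟩ := M.V_abs_le
  refine sub_nonpos.1 (M.nonpos_of_contraction (f := fun s => v s - M.V π s) (C := C + K)
    (fun s => ?_) (fun D _ hD s => ?_) s)
  · linarith [(abs_le.1 (hC s)).2, (abs_le.1 (hK π s)).1]
  · have h1 := integral_le_of_le (π.ker s) (M.integrable_lookahead hv hC s _)
      (M.integrable_lookahead (M.measurable_V π) (hK π) s _) (D := M.γ * D) fun a =>
        M.lookahead_sub_le (integrable_of_bounded hv hC _)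
          (integrable_of_bounded (M.measurable_V π) (hK π) _) hD
    rw [← M.V_eq_integral_lookahead] at h1
    linarith [h s]

/-- A bounded supersolution of the Bellman equation of `π` lies above `V^π`. -/
theorem V_le_of_le (π : M.Policy) {v : S → ℝ} (hv : Measurable v) {C : ℝ} (hC : ∀ s, |v s| ≤ C)
    (h : ∀ s, ∫ a, M.lookahead v (s, a) ∂(π.ker s) ≤ v s) (s : S) : M.V π s ≤ v s := by
  obtain ⟨K, hK⟩ := M.V_abs_le
  refine sub_nonpos.1 (M.nonpos_of_contraction (f := fun s => M.V π s - v s) (C := K + C)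
    (fun s => ?_) (fun D _ hD s => ?_) s)
  · linarith [(abs_le.1 (hC s)).1, (abs_le.1 (hK π s)).2]
  · have h1 := integral_le_of_le (π.ker s) (M.integrable_lookahead (M.measurable_V π) (hK π) s _)
      (M.integrable_lookahead hv hC s _) (D := M.γ * D) fun a =>
        M.lookahead_sub_le (integrable_of_bounded (M.measurable_V π) (hK π) _)
          (integrable_of_bounded hv hC _) hD
    rw [← M.V_eq_integral_lookahead] at h1
    linarith [h s]

/-! ### Optimality -/

theorem T_eq_lookahead (q : S × A → ℝ) : M.T q = M.lookahead fun s => ⨆ a, q (s, a) := rfl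

theorem iSup_sub_iSup_le {X : Type*} {f g : X → ℝ} {C D : ℝ} (hg : ∀ x, g x ≤ C) (hD : 0 ≤ D)
    (h : ∀ x, f x - g x ≤ D) : (⨆ x, f x) - ⨆ x, g x ≤ D := by
  -- Over an empty type both suprema are 0 by convention, which is where `hD` is needed.
  rcases isEmpty_or_nonempty X with hX | hX
  · simpa using hD
  · have hb : BddAbove (Set.range g) := ⟨C, by rintro _ ⟨x, rfl⟩; exact hg x⟩
    have : ⨆ x, f x ≤ D + ⨆ x, g x := ciSup_le fun x => by linarith [h x, le_ciSup hb x]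
    linarith

theorem abs_iSup_le {X : Type*} {f : X → ℝ} {C : ℝ} (hC0 : 0 ≤ C) (h : ∀ x, |f x| ≤ C) :
    |⨆ x, f x| ≤ C := by
  rcases isEmpty_or_nonempty X with hX | ⟨⟨x⟩⟩
  · simpa using hC0
  · have hb : BddAbove (Set.range f) := ⟨C, by rintro _ ⟨x, rfl⟩; exact (abs_le.1 (h x)).2⟩
    have : Nonempty X := ⟨x⟩
    exact abs_le.2 ⟨(abs_le.1 (h x)).1.trans (le_ciSup hb x),
      ciSup_le fun x => (abs_le.1 (h x)).2⟩

theorem IsBellmanFixedPoint.le {q q' : S × A → ℝ} (hq : M.IsBellmanFixedPoint q)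
    (hq' : M.IsBellmanFixedPoint q') (x : S × A) : q x ≤ q' x := by
  obtain ⟨-, ⟨C, hC⟩, hs, hT⟩ := hq
  obtain ⟨-, ⟨C', hC'⟩, hs', hT'⟩ := hq'
  refine sub_nonpos.1 (M.nonpos_of_contraction (f := fun x => q x - q' x) (C := C + C')
    (fun x => ?_) (fun D hD0 hD x => ?_) x)
  · linarith [(abs_le.1 (hC x)).2, (abs_le.1 (hC' x)).1]
  · have hC0 := (abs_nonneg _).trans (hC x)
    have hC0' := (abs_nonneg _).trans (hC' x)
    have h := M.lookahead_sub_le (x := x) (D := D)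
      (integrable_of_bounded hs (fun s => abs_iSup_le hC0 fun a => hC (s, a)) _)
      (integrable_of_bounded hs' (fun s => abs_iSup_le hC0' fun a => hC' (s, a)) _)
      (fun s => iSup_sub_iSup_le (C := C') (fun a => (abs_le.1 (hC' (s, a))).2) hD0
        fun a => hD (s, a))
    rwa [← T_eq_lookahead, ← T_eq_lookahead, hT, hT'] at h

theorem IsBellmanFixedPoint.isOptimalActionValue {q : S × A → ℝ} (hq : M.IsBellmanFixedPoint q) :
    M.IsOptimalActionValue q :=
  ⟨hq, fun _ hq' => funext fun x => le_antisymm (hq'.le M hq x) (hq.le M hq' x)⟩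

/-- The Bellman optimality equation for a pair of state values and action values. -/
structure IsOptimalPair (v : S → ℝ) (q : S × A → ℝ) : Prop where
  measurable : Measurable v
  bounded : ∃ C, ∀ s, |v s| ≤ C
  eq_lookahead : q = M.lookahead v
  isLUB : ∀ s, IsLUB (Set.range fun a => q (s, a)) (v s)

variable {M}

theorem IsOptimalPair.iSup_eq {v : S → ℝ} {q : S × A → ℝ} (h : M.IsOptimalPair v q)
    (s : S) : ⨆ a, q (s, a) = v s := (h.isLUB s).csSup_eq (h.isLUB s).nonempty

theorem IsOptimalPair.isOptimalActionValue {v : S → ℝ} {q : S × A → ℝ}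
    (h : M.IsOptimalPair v q) : M.IsOptimalActionValue q := by
  obtain ⟨C, hC⟩ := h.bounded
  refine IsBellmanFixedPoint.isOptimalActionValue M ⟨?_, ?_, ?_, ?_⟩
  · rw [h.eq_lookahead]
    exact M.measurable_lookahead h.measurable
  · rw [h.eq_lookahead]
    exact M.exists_abs_lookahead_le hC
  · simp_rw [h.iSup_eq]
    exact h.measurable
  · rw [T_eq_lookahead]
    simp_rw [h.iSup_eq]
    exact h.eq_lookahead.symm

/-- Since `q (s, ·) ≤ v s`, the function `v` is a supersolution for every policy. -/
theorem IsOptimalPair.V_le {v : S → ℝ} {q : S × A → ℝ} (h : M.IsOptimalPair v q) (π : M.Policy)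
    (s : S) : M.V π s ≤ v s := by
  obtain ⟨C, hC⟩ := h.bounded
  refine M.V_le_of_le π h.measurable hC (fun s => ?_) s
  calc ∫ a, M.lookahead v (s, a) ∂(π.ker s) ≤ ∫ _, v s ∂(π.ker s) :=
        integral_mono (M.integrable_lookahead h.measurable hC s _) (integrable_const _)
          fun a => by
            have := (h.isLUB s).1 ⟨a, rfl⟩
            rwa [h.eq_lookahead] at this
    _ = v s := by simp

theorem IsOptimalPair.eq_of_mem_argmaxSet {v : S → ℝ} {q : S × A → ℝ} (h : M.IsOptimalPair v q)
    {s : S} {a : A} (ha : a ∈ argmaxSet q s) : q (s, a) = v s :=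
  (IsGreatest.isLUB ⟨⟨a, rfl⟩, by rintro _ ⟨a', rfl⟩; exact ha a'⟩ :
    IsLUB (Set.range fun a => q (s, a)) (q (s, a))).unique (h.isLUB s)

theorem IsOptimalPair.mem_argmaxSet {v : S → ℝ} {q : S × A → ℝ} (h : M.IsOptimalPair v q)
    {s : S} {a : A} : a ∈ argmaxSet q s ↔ q (s, a) = v s :=
  ⟨h.eq_of_mem_argmaxSet, fun ha a' => ha ▸ (h.isLUB s).1 ⟨a', rfl⟩⟩

theorem IsOptimalPair.measurableSet_argmaxSet {v : S → ℝ} {q : S × A → ℝ}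
    (h : M.IsOptimalPair v q) (s : S) : MeasurableSet (argmaxSet q s) := by
  have : argmaxSet q s = (fun a => q (s, a)) ⁻¹' {v s} := by
    ext a
    exact h.mem_argmaxSet
  rw [this, h.eq_lookahead]
  exact ((M.measurable_lookahead h.measurable).comp measurable_prodMk_left)
    (measurableSet_singleton _)

/-- A greedy policy sees `q (s, ·) = v s` almost surely, so `v` is also a subsolution for it. -/
theorem IsOptimalPair.V_eq {v : S → ℝ} {q : S × A → ℝ} (h : M.IsOptimalPair v q)
    {π : M.Policy} (hπ : M.IsGreedy q π) : M.V π = v := by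
  ext s
  obtain ⟨C, hC⟩ := h.bounded
  refine le_antisymm (h.V_le π s) (M.le_V_of_le π h.measurable hC (fun s => ?_) s)
  have hae : ∀ᵐ a ∂(π.ker s), M.lookahead v (s, a) = v s := by
    filter_upwards [(mem_ae_iff_prob_eq_one (h.measurableSet_argmaxSet s)).2 (hπ s)] with a ha
    rw [← h.eq_lookahead]
    exact h.eq_of_mem_argmaxSet ha
  rw [integral_congr_ae hae]
  simp

theorem IsOptimalPair.Q_eq {v : S → ℝ} {q : S × A → ℝ} (h : M.IsOptimalPair v q)
    {π : M.Policy} (hπ : M.IsGreedy q π) : M.Q π = q := by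
  rw [Q_eq_lookahead, h.V_eq hπ, h.eq_lookahead]

theorem IsOptimalPair.isOptimalStateValue {v : S → ℝ} {q : S × A → ℝ} (h : M.IsOptimalPair v q)
    {π : M.Policy} (hπ : M.IsGreedy q π) : M.IsOptimalStateValue v := fun s =>
  ⟨⟨π, congrFun (h.V_eq hπ) s⟩, by rintro _ ⟨π', rfl⟩; exact h.V_le π' s⟩

end CompactMDP

namespace CompactMDP

variable {S A : Type*} [MetricSpace S] [CompactSpace S] [MeasurableSpace S]
  [OpensMeasurableSpace S] [MetricSpace A] [CompactSpace A] [MeasurableSpace A] [BorelSpace A]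
  {M : CompactMDP S A}

/-! ### The update operator -/

theorem DensityPolicy.integral_toPolicy (π : M.DensityPolicy) (s : S) (f : A → ℝ) :
    ∫ a, f a ∂(π.toPolicy.ker s) = ∫ a, π.dens s a * f a ∂M.muA := by
  have hm : Measurable fun a => π.dens s a := π.measurable_dens.comp measurable_prodMk_left
  rw [π.toPolicy_apply, integral_withDensity_eq_integral_toReal_smul hm.ennreal_ofReal
    (ae_of_all _ fun _ => ENNReal.ofReal_lt_top)]
  simp_rw [ENNReal.toReal_ofReal (π.nonneg s _), smul_eq_mul]

theorem integral_B (π : M.DensityPolicy) (s : S) (f : A → ℝ) :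
    ∫ a, f a ∂((M.B π).toPolicy.ker s) =
      (∫ a, M.Q π.toPolicy (s, a) * f a ∂(π.toPolicy.ker s)) / M.V π.toPolicy s := by
  rw [DensityPolicy.integral_toPolicy, DensityPolicy.integral_toPolicy, ← integral_div]
  refine integral_congr_ae (ae_of_all _ fun a => ?_)
  simp only [B]
  ring

theorem integrable_Q_action (π : M.Policy) (s : S) (μ : Measure A) [IsFiniteMeasure μ] :
    Integrable (fun a => M.Q π (s, a)) μ := by
  obtain ⟨C, hC⟩ := M.V_abs_le
  rw [M.Q_eq_lookahead]
  exact M.integrable_lookahead (M.measurable_V π) (hC π) s μ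

theorem real_B (π : M.DensityPolicy) (s : S) {E : Set A} (hE : MeasurableSet E) :
    ((M.B π).toPolicy.ker s).real E =
      (∫ a in E, M.Q π.toPolicy (s, a) ∂(π.toPolicy.ker s)) / M.V π.toPolicy s := by
  rw [← integral_indicator_one hE, integral_B, ← integral_indicator hE]
  congr 2
  ext a
  by_cases ha : a ∈ E <;> simp [ha]

/-- The tilt `Q / V` is a local growth factor for mass. This bound drives the decay on suboptimal
actions; its counterpart `le_real_B` drives the growth argument by contradiction. -/
theorem real_B_le (π : M.DensityPolicy) (s : S) {E : Set A} (hE : MeasurableSet E) {c : ℝ}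
    (hc : ∀ a ∈ E, M.Q π.toPolicy (s, a) ≤ c) :
    ((M.B π).toPolicy.ker s).real E ≤
      c / M.V π.toPolicy s * (π.toPolicy.ker s).real E := by
  rw [real_B π s hE, div_mul_eq_mul_div]
  refine div_le_div_of_nonneg_right ?_ (M.V_pos _ s).le
  calc _ ≤ ∫ _ in E, c ∂(π.toPolicy.ker s) := setIntegral_mono_on
        (integrable_Q_action _ s _).integrableOn (integrable_const c).integrableOn hE hc
    _ = _ := by rw [setIntegral_const, smul_eq_mul, mul_comm]

theorem le_real_B (π : M.DensityPolicy) (s : S) {E : Set A} (hE : MeasurableSet E) {c : ℝ}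
    (hc : ∀ a ∈ E, c ≤ M.Q π.toPolicy (s, a)) :
    c / M.V π.toPolicy s * (π.toPolicy.ker s).real E ≤
      ((M.B π).toPolicy.ker s).real E := by
  rw [real_B π s hE, div_mul_eq_mul_div]
  refine div_le_div_of_nonneg_right ?_ (M.V_pos _ s).le
  calc _ = ∫ _ in E, c ∂(π.toPolicy.ker s) := by rw [setIntegral_const, smul_eq_mul, mul_comm]
    _ ≤ _ := setIntegral_mono_on
        (integrable_const c).integrableOn (integrable_Q_action _ s _).integrableOn hE hc

theorem B_dens_pos {π : M.DensityPolicy} (h : ∀ s a, 0 < π.dens s a) (s : S) (a : A) :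
    0 < (M.B π).dens s a :=
  div_pos (mul_pos (M.Q_pos _ _) (h s a)) (M.V_pos _ _)

theorem real_pos_of_isOpen {π : M.DensityPolicy} (h : ∀ s a, 0 < π.dens s a) (s : S) {U : Set A}
    (hU : IsOpen U) (hne : U.Nonempty) : 0 < (π.toPolicy.ker s).real U := by
  have hm : Measurable fun a => π.dens s a := π.measurable_dens.comp measurable_prodMk_left
  refine ENNReal.toReal_pos (fun h0 => ?_) (measure_ne_top _ _)
  rw [π.toPolicy_apply, withDensity_apply_eq_zero hm.ennreal_ofReal] at h0
  have : {a | ENNReal.ofReal (π.dens s a) ≠ 0} = Set.univ :=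
    Set.eq_univ_of_forall fun a => by simpa using h s a
  rw [this, Set.univ_inter] at h0
  exact hU.measure_ne_zero M.muA hne h0

/-- The right side is `(∫ Q²) / V` with `V = ∫ Q`, so the claim is that the variance of `Q` under
the old policy is nonnegative. -/
theorem V_le_integral_Q_B (π : M.DensityPolicy) (s : S) :
    M.V π.toPolicy s ≤ ∫ a, M.Q π.toPolicy (s, a) ∂((M.B π).toPolicy.ker s) := by
  obtain ⟨C, hC, -⟩ := M.exists_value_le
  set μ := π.toPolicy.ker s
  set v := M.V π.toPolicy s
  have hQ := integrable_Q_action π.toPolicy s μ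
  have hQQ : Integrable (fun a => M.Q π.toPolicy (s, a) * M.Q π.toPolicy (s, a)) μ :=
    hQ.bdd_mul (c := C) hQ.aestronglyMeasurable (ae_of_all _ fun a => by
      rw [Real.norm_of_nonneg (M.Q_pos _ _).le]
      exact hC _ _)
  have hVQ : v = ∫ a, M.Q π.toPolicy (s, a) ∂μ := M.V_eq_integral_Q _ s
  have h : 0 ≤ ∫ a, (M.Q π.toPolicy (s, a) * M.Q π.toPolicy (s, a) -
      (2 * v) * M.Q π.toPolicy (s, a) + v ^ 2) ∂μ :=
    integral_nonneg fun a => by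
      have := sq_nonneg (M.Q π.toPolicy (s, a) - v)
      simp only [Pi.zero_apply]
      linarith
  have hsub : Integrable (fun a => M.Q π.toPolicy (s, a) * M.Q π.toPolicy (s, a) -
      (2 * v) * M.Q π.toPolicy (s, a)) μ := hQQ.sub (hQ.const_mul _)
  rw [integral_add hsub (integrable_const _), integral_sub hQQ (hQ.const_mul _),
    integral_const_mul, ← hVQ] at h
  simp only [integral_const, probReal_univ, one_smul] at h
  rw [integral_B, le_div_iff₀ (M.V_pos _ s)]
  linarith

/-- Policy improvement. -/
theorem V_le_V_B (π : M.DensityPolicy) (s : S) :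
    M.V π.toPolicy s ≤ M.V (M.B π).toPolicy s := by
  obtain ⟨C, hC⟩ := M.V_abs_le
  refine M.le_V_of_le _ (M.measurable_V _) (hC _) (fun s => ?_) s
  rw [← M.Q_eq_lookahead]
  exact V_le_integral_Q_B π s

theorem lookahead_mono {v w : S → ℝ} {x : S × A} (hv : Integrable v (M.P x))
    (hw : Integrable w (M.P x)) (h : ∀ s, v s ≤ w s) : M.lookahead v x ≤ M.lookahead w x := by
  have := M.lookahead_sub_le hv hw (D := 0) fun s => sub_nonpos.2 (h s)
  simpa using this

/-! ### Limits of the iteration -/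

section Iteration

variable {π : ℕ → M.DensityPolicy} {v : S → ℝ}

theorem monotone_V (hB : ∀ n, π (n + 1) = M.B (π n))
    (s : S) : Monotone fun n => M.V (π n).toPolicy s :=
  monotone_nat_of_le_succ fun n => by rw [hB]; exact V_le_V_B (π n) s

theorem monotone_Q (hB : ∀ n, π (n + 1) = M.B (π n))
    (x : S × A) : Monotone fun n => M.Q (π n).toPolicy x := by
  intro m n hmn
  obtain ⟨C, hC⟩ := M.V_abs_le
  simp only [Q_eq_lookahead]
  exact lookahead_mono (integrable_of_bounded (M.measurable_V _) (hC _) _)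
    (integrable_of_bounded (M.measurable_V _) (hC _) _) fun s => monotone_V hB s hmn

theorem dens_pos (hB : ∀ n, π (n + 1) = M.B (π n))
    (hpos : ∀ s a, 0 < (π 0).dens s a) (n : ℕ) : ∀ s a, 0 < (π n).dens s a := by
  induction n with
  | zero => exact hpos
  | succ n ih => rw [hB]; exact B_dens_pos ih

theorem exists_tendsto_V (hB : ∀ n, π (n + 1) = M.B (π n)) : ∃ v : S → ℝ,
    ∀ s, Tendsto (fun n => M.V (π n).toPolicy s) atTop (𝓝 (v s)) := by
  obtain ⟨C, -, hC⟩ := M.exists_value_le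
  exact ⟨_, fun s => tendsto_atTop_ciSup (monotone_V hB s)
    ⟨C, by rintro _ ⟨n, rfl⟩; exact hC _ s⟩⟩

theorem tendsto_Q
    (hv : ∀ s, Tendsto (fun n => M.V (π n).toPolicy s) atTop (𝓝 (v s)))
    (x : S × A) :
    Tendsto (fun n => M.Q (π n).toPolicy x) atTop (𝓝 (M.lookahead v x)) := by
  obtain ⟨C, hC⟩ := M.V_abs_le
  simp_rw [Q_eq_lookahead]
  exact M.tendsto_lookahead (fun n => M.measurable_V _) (fun n => hC _) hv x

theorem measurable_limit
    (hv : ∀ s, Tendsto (fun n => M.V (π n).toPolicy s) atTop (𝓝 (v s))) : Measurable v :=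
  measurable_of_tendsto_metrizable (fun n => M.measurable_V (π n).toPolicy) (tendsto_pi_nhds.2 hv)

theorem limit_nonneg
    (hv : ∀ s, Tendsto (fun n => M.V (π n).toPolicy s) atTop (𝓝 (v s)))
    (s : S) : 0 ≤ v s := ge_of_tendsto' (hv s) fun _ => (M.V_pos _ s).le

theorem exists_limit_le
    (hv : ∀ s, Tendsto (fun n => M.V (π n).toPolicy s) atTop (𝓝 (v s))) : ∃ C, ∀ s, v s ≤ C := by
  obtain ⟨C, -, hC⟩ := M.exists_value_le
  exact ⟨C, fun s => le_of_tendsto' (hv s) fun _ => hC _ s⟩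

theorem continuous_lookahead_limit
    (hv : ∀ s, Tendsto (fun n => M.V (π n).toPolicy s) atTop (𝓝 (v s))) : Continuous (M.lookahead v) := by
  obtain ⟨C, hC⟩ := exists_limit_le hv
  exact M.continuous_lookahead (measurable_limit hv) (limit_nonneg hv) hC

theorem continuous_Q (ϖ : M.Policy) : Continuous (M.Q ϖ) := by
  obtain ⟨C, -, hC⟩ := M.exists_value_le
  rw [M.Q_eq_lookahead]
  exact M.continuous_lookahead (M.measurable_V ϖ) (fun s => (M.V_pos ϖ s).le) (hC ϖ)

/-- If some action were strictly better than the limit value, the mass of a neighbourhood of it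
would grow geometrically. -/
theorem lookahead_limit_le (hB : ∀ n, π (n + 1) = M.B (π n))
    (hv : ∀ s, Tendsto (fun n => M.V (π n).toPolicy s) atTop (𝓝 (v s)))
    (hpos : ∀ s a, 0 < (π 0).dens s a) (s : S) (a : A) :
    M.lookahead v (s, a) ≤ v s := by
  by_contra! hlt
  obtain ⟨c, hvc, hcq⟩ := exists_between hlt
  -- Defining `U` from the single function `Q_N` makes it open; monotonicity in `n` keeps `c` a
  -- lower bound on `U` at all later times.
  obtain ⟨N, hN⟩ := ((tendsto_Q hv (s, a)).eventually (lt_mem_nhds hcq)).exists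
  have hvpos : 0 < v s := (M.V_pos _ s).trans_le ((monotone_V hB s).ge_of_tendsto (hv s) 0)
  set U : Set A := {a | c < M.Q (π N).toPolicy (s, a)}
  have hU : IsOpen U :=
    isOpen_lt continuous_const ((continuous_Q _).comp (Continuous.prodMk_right s))
  have hr : 1 < c / v s := (one_lt_div hvpos).2 hvc
  -- The growth factor at time `n` is at least `c / V_n s`, hence at least `c / v s`, because `V_n s
  -- ≤ v s`.
  have hgrow : ∀ k, (c / v s) ^ k * ((π N).toPolicy.ker s).real U ≤
      ((π (N + k)).toPolicy.ker s).real U := by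
    intro k
    induction k with
    | zero => simp
    | succ k ih =>
      rw [pow_succ', mul_assoc, ← Nat.add_assoc, hB]
      refine le_trans ?_ (le_real_B _ s hU.measurableSet (c := c) fun b hb =>
        (le_of_lt hb).trans (monotone_Q hB (s, b) (Nat.le_add_right N k)))
      refine mul_le_mul ?_ ih (by positivity) (div_nonneg (hvpos.trans hvc).le (M.V_pos _ s).le)
      exact div_le_div_of_nonneg_left (hvpos.trans hvc).le (M.V_pos _ s)
        ((monotone_V hB s).ge_of_tendsto (hv s) _)
  have hp := real_pos_of_isOpen (dens_pos hB hpos N) s hU ⟨a, hN⟩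
  obtain ⟨k, hk⟩ := pow_unbounded_of_one_lt (((π N).toPolicy.ker s).real U)⁻¹ hr
  have h1 : (1 : ℝ) < (c / v s) ^ k * ((π N).toPolicy.ker s).real U :=
    (inv_lt_iff_one_lt_mul₀ hp).1 hk
  exact (h1.trans_le (hgrow k)).not_ge measureReal_le_one

theorem isOptimalPair_limit (hB : ∀ n, π (n + 1) = M.B (π n))
    (hv : ∀ s, Tendsto (fun n => M.V (π n).toPolicy s) atTop (𝓝 (v s)))
    (hpos : ∀ s a, 0 < (π 0).dens s a) :
    M.IsOptimalPair v (M.lookahead v) where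
  measurable := measurable_limit hv
  bounded := by
    obtain ⟨C, hC⟩ := exists_limit_le hv
    exact ⟨C, fun s => by rw [abs_of_nonneg (limit_nonneg hv s)]; exact hC s⟩
  eq_lookahead := rfl
  isLUB s := by
    refine ⟨by rintro _ ⟨a, rfl⟩; exact lookahead_limit_le hB hv hpos s a, fun b hb => ?_⟩
    -- `V_n s` averages `Q_n (s, ·)`, which lies below its limit and hence below `b`.
    refine le_of_tendsto' (hv s) fun n => ?_
    rw [M.V_eq_integral_Q]
    calc _ ≤ ∫ _, b ∂((π n).toPolicy.ker s) :=
          integral_mono (integrable_Q_action _ s _) (integrable_const _) fun a =>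
            ((monotone_Q hB (s, a)).ge_of_tendsto (tendsto_Q hv (s, a)) n).trans (hb ⟨a, rfl⟩)
      _ = b := by simp

/-- The iterates lose all mass on compact sets of suboptimal actions. -/
theorem tendsto_real_zero (hB : ∀ n, π (n + 1) = M.B (π n))
    (hv : ∀ s, Tendsto (fun n => M.V (π n).toPolicy s) atTop (𝓝 (v s)))
    (s : S) {K : Set A} (hK : IsCompact K)
    (hlt : ∀ a ∈ K, M.lookahead v (s, a) < v s) :
    Tendsto (fun n => ((π n).toPolicy.ker s).real K) atTop (𝓝 0) := by
  rcases K.eq_empty_or_nonempty with rfl | hne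
  · simp
  obtain ⟨b, hb, hmax⟩ := hK.exists_isMaxOn hne
    ((continuous_lookahead_limit hv).comp (Continuous.prodMk_right s)).continuousOn
  -- Once `V_n s` exceeds `c`, an update scales the mass of `K` by at most the ratio of the maximum
  -- over `K` to `c`, which is below 1.
  obtain ⟨c, hbc, hcv⟩ := exists_between (hlt b hb)
  obtain ⟨N, hN⟩ := eventually_atTop.1 ((hv s).eventually (lt_mem_nhds hcv))
  have hQle : ∀ n a, M.Q (π n).toPolicy (s, a) ≤ M.lookahead v (s, a) := fun n a =>
    (monotone_Q hB (s, a)).ge_of_tendsto (tendsto_Q hv (s, a)) n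
  have hb0 : 0 < M.lookahead v (s, b) := (M.Q_pos _ _).trans_le (hQle 0 b)
  have hc0 := hb0.trans hbc
  have hdecay : ∀ k, ((π (k + N)).toPolicy.ker s).real K ≤ (M.lookahead v (s, b) / c) ^ k := by
    intro k
    induction k with
    | zero => simp
    | succ k ih =>
      rw [pow_succ', Nat.succ_add, hB]
      refine (real_B_le _ s hK.measurableSet (c := M.lookahead v (s, b)) fun a ha =>
        (hQle _ a).trans (hmax ha)).trans ?_
      refine mul_le_mul ?_ ih measureReal_nonneg (by positivity)
      exact div_le_div_of_nonneg_left hb0.le hc0 (hN _ (Nat.le_add_left N k)).le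
  refine (tendsto_add_atTop_iff_nat N).1 (squeeze_zero (fun _ => measureReal_nonneg) hdecay ?_)
  exact tendsto_pow_atTop_nhds_zero_of_lt_one (by positivity) ((div_lt_one hc0).2 hbc)

end Iteration

end CompactMDP

/-! ### Weak convergence relative to a set, and measurable selections -/

/-- Probability measures that lose all mass on compact sets disjoint from `F` converge weakly
relative to `F` to every probability measure carried by `F`. -/
theorem tendstoWeaklyRel_of_tendsto_zero {X : Type*} [TopologicalSpace X] [CompactSpace X]
    [MeasurableSpace X] [OpensMeasurableSpace X] {F : Set X}
    {μ : ℕ → ProbabilityMeasure X} {μ' : ProbabilityMeasure X}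
    (hF : ∀ᵐ x ∂(μ' : Measure X), x ∈ F)
    (h : ∀ K : Set X, IsClosed K → Disjoint K F →
      Tendsto (fun n => (μ n : Measure X).real K) atTop (𝓝 0)) :
    TendstoWeaklyRel F μ μ' := by
  refine ProbabilityMeasure.tendsto_iff_forall_integral_tendsto.2 fun g => ?_
  obtain ⟨x₀, hx₀⟩ := hF.exists
  have hgc : Continuous fun x => g (Collapse.mk F x) := g.continuous.comp (Collapse.continuous_mk F)
  have hmap : ∀ ν : ProbabilityMeasure X,
      ∫ y, g y ∂(ν.map (Collapse.measurable_mk F).aemeasurable : Measure (Collapse F)) =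
        ∫ x, g (Collapse.mk F x) ∂(ν : Measure X) := fun ν =>
    integral_map (Collapse.measurable_mk F).aemeasurable
      g.continuous.measurable.aestronglyMeasurable
  set c := g (Collapse.mk F x₀)
  have hc : ∀ x ∈ F, g (Collapse.mk F x) = c := fun x hx =>
    congrArg g (Quotient.sound (Or.inr ⟨hx, hx₀⟩))
  have hlim : ∫ x, g (Collapse.mk F x) ∂(μ' : Measure X) = c := by
    rw [integral_congr_ae (hF.mono fun x hx => hc x hx)]
    simp
  simp_rw [hmap, hlim]
  have hint : ∀ ν : ProbabilityMeasure X,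
      Integrable (fun x => g (Collapse.mk F x)) (ν : Measure X) := fun ν =>
    Integrable.of_bound hgc.measurable.aestronglyMeasurable ‖g‖
      (ae_of_all _ fun x => g.norm_coe_le_norm _)
  refine Metric.tendsto_atTop.2 fun ε hε => ?_
  -- The test function equals `c` on `F`, so `K` misses `F` and loses its mass. Off `K` the error is
  -- below `ε / 2`; on `K` it is at most `2 * ‖g‖`.
  set K : Set X := {x | ε / 2 ≤ |g (Collapse.mk F x) - c|}
  have hK : IsClosed K := isClosed_le continuous_const (hgc.sub continuous_const).abs
  have hKF : Disjoint K F := Set.disjoint_left.2 fun x hx hxF => by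
    have : ε / 2 ≤ |g (Collapse.mk F x) - c| := hx
    rw [hc x hxF, sub_self, abs_zero] at this
    linarith
  have hev := ((h K hK hKF).const_mul (2 * ‖g‖)).eventually_lt_const
    (show 2 * ‖g‖ * 0 < ε / 2 by simpa using hε)
  obtain ⟨N, hN⟩ := eventually_atTop.1 hev
  refine ⟨N, fun n hn => ?_⟩
  have hle : ∀ x, |g (Collapse.mk F x) - c| ≤ ε / 2 + 2 * ‖g‖ * K.indicator 1 x := by
    intro x
    by_cases hx : x ∈ K
    · have h1 := g.norm_coe_le_norm (Collapse.mk F x)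
      have h2 := g.norm_coe_le_norm (Collapse.mk F x₀)
      have h3 := norm_sub_le (g (Collapse.mk F x)) c
      rw [Real.norm_eq_abs] at h3
      simp only [hx, Set.indicator_of_mem, Pi.one_apply]
      linarith
    · have : |g (Collapse.mk F x) - c| < ε / 2 := not_le.1 hx
      simpa [hx] using this.le
  have hK1 : Integrable (fun x => 2 * ‖g‖ * K.indicator (1 : X → ℝ) x) (μ n : Measure X) :=
    ((integrable_const (1 : ℝ)).indicator hK.measurableSet).const_mul _
  calc dist (∫ x, g (Collapse.mk F x) ∂(μ n : Measure X)) c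
      = |∫ x, (g (Collapse.mk F x) - c) ∂(μ n : Measure X)| := by
        rw [integral_sub (hint _) (integrable_const _), Real.dist_eq]
        simp
    _ ≤ ∫ x, |g (Collapse.mk F x) - c| ∂(μ n : Measure X) := abs_integral_le_integral_abs
    _ ≤ ∫ x, (ε / 2 + 2 * ‖g‖ * K.indicator 1 x) ∂(μ n : Measure X) :=
        integral_mono ((hint _).sub (integrable_const _)).abs ((integrable_const _).add hK1) hle
    _ = ε / 2 + 2 * ‖g‖ * (μ n : Measure X).real K := by
        rw [integral_add (integrable_const _) hK1, integral_const_mul,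
          integral_indicator_one hK.measurableSet]
        simp
    _ < ε := by linarith [hN n hn]

/-! ### Measurable selection from closed relations by successive approximation -/

section Selection

variable {S A : Type*} [TopologicalSpace S] [MeasurableSpace S]
  [OpensMeasurableSpace S] [MetricSpace A] [CompactSpace A] [MeasurableSpace A] [BorelSpace A]

/-- An approximate measurable selection of a closed relation can be refined. -/
theorem exists_measurable_refinement {G : Set (S × A)} (hG : IsClosed G) {f : S → A}
    (hf : Measurable f) {r r' : ℝ} (hr' : 0 < r')
    (h : ∀ s, ∃ a, (s, a) ∈ G ∧ dist a (f s) ≤ r) :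
    ∃ f' : S → A, Measurable f' ∧
      ∀ s, ∃ a, (s, a) ∈ G ∧ dist a (f s) ≤ r ∧ dist a (f' s) ≤ r' := by
  classical
  rcases isEmpty_or_nonempty A with hA | hA
  · exact ⟨f, hf, fun s => hA.elim (f s)⟩
  set p : S → ℕ → Prop := fun s i => ∃ a, (s, a) ∈ G ∧ dist a (f s) ≤ r ∧
    dist a (TopologicalSpace.denseSeq A i) ≤ r'
  have hp : ∀ s, ∃ i, p s i := by
    intro s
    obtain ⟨a, ha, har⟩ := h s
    obtain ⟨i, hi⟩ := (TopologicalSpace.denseRange_denseSeq A).exists_dist_lt a hr'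
    exact ⟨i, a, ha, har, hi.le⟩
  have hm : ∀ i, MeasurableSet {s | p s i} := by
    intro i
    -- The centre `f s` is replaced by a free variable, since `f` is only measurable; projecting
    -- along the compact factor `A` keeps the set closed, and pulling back by `s ↦ (s, f s)` gives
    -- measurability.
    have hcl : IsClosed (Prod.fst '' {z : (S × A) × A | (z.1.1, z.2) ∈ G ∧
        dist z.2 z.1.2 ≤ r ∧ dist z.2 (TopologicalSpace.denseSeq A i) ≤ r'}) := by
      refine isClosedMap_fst_of_compactSpace _ ?_
      rw [Set.ofPred_and, Set.ofPred_and]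
      refine (hG.preimage (by fun_prop)).inter ((isClosed_le ?_ ?_).inter (isClosed_le ?_ ?_)) <;>
        fun_prop
    have : {s | p s i} = (fun s => (s, f s)) ⁻¹' (Prod.fst '' {z : (S × A) × A |
        (z.1.1, z.2) ∈ G ∧ dist z.2 z.1.2 ≤ r ∧
          dist z.2 (TopologicalSpace.denseSeq A i) ≤ r'}) := by
      ext s
      constructor
      · rintro ⟨a, ha⟩
        exact ⟨((s, f s), a), ha, rfl⟩
      · rintro ⟨⟨z, a⟩, ha, rfl⟩
        exact ⟨a, ha⟩
    rw [this]
    exact (measurable_id.prodMk hf) hcl.measurableSet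
  exact ⟨fun s => TopologicalSpace.denseSeq A (Nat.find (hp s)),
    measurable_from_nat.comp (measurable_find hp hm), fun s => Nat.find_spec (hp s)⟩

/-- A closed relation with nonempty fibres and compact values has a measurable selection. -/
theorem exists_measurable_selection {G : Set (S × A)} (hG : IsClosed G)
    (hne : ∀ s, ∃ a, (s, a) ∈ G) : ∃ f : S → A, Measurable f ∧ ∀ s, (s, f s) ∈ G := by
  rcases isEmpty_or_nonempty S with hS | ⟨⟨s₀⟩⟩
  · exact ⟨fun s => hS.elim s, measurable_of_empty _, fun s => hS.elim s⟩
  obtain ⟨a₀, -⟩ := hne s₀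
  set D : ℝ := Metric.diam (Set.univ : Set A) + 1
  have hD : 0 < D := add_pos_of_nonneg_of_pos Metric.diam_nonneg one_pos
  let P : ℕ → (S → A) → Prop := fun k f =>
    Measurable f ∧ ∀ s, ∃ a, (s, a) ∈ G ∧ dist a (f s) ≤ D * (1 / 2) ^ k
  have h0 : P 0 fun _ => a₀ := ⟨measurable_const, fun s => by
    obtain ⟨a, ha⟩ := hne s
    refine ⟨a, ha, ?_⟩
    have := Metric.dist_le_diam_of_mem isCompact_univ.isBounded (Set.mem_univ a) (Set.mem_univ a₀)
    rw [pow_zero, mul_one]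
    linarith⟩
  have hstep : ∀ k (f : {f // P k f}), ∃ f' : {f // P (k + 1) f},
      ∀ s, dist (f.1 s) (f'.1 s) ≤ 2 * D * (1 / 2) ^ k := by
    -- The refinement retains one point of the fibre close to both `f s` and `f' s`. This bounds
    -- their distance, so the approximations form a geometric Cauchy sequence.
    rintro k ⟨f, hf, hfa⟩
    obtain ⟨f', hf', h⟩ := exists_measurable_refinement hG hf
      (r' := D * (1 / 2) ^ (k + 1)) (by positivity) hfa
    refine ⟨⟨f', hf', fun s => ?_⟩, fun s => ?_⟩
    · obtain ⟨a, ha, -, h2⟩ := h s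
      exact ⟨a, ha, h2⟩
    · obtain ⟨a, -, h1, h2⟩ := h s
      have h3 := dist_triangle_left (f s) (f' s) a
      have h4 : D * (1 / 2) ^ (k + 1) ≤ D * (1 / 2) ^ k := by
        rw [pow_succ]
        have : 0 < D * (1 / 2) ^ k := by positivity
        linarith
      linarith
  choose next hnext using hstep
  let F : ∀ k, {f // P k f} := fun k => Nat.rec ⟨_, h0⟩ (fun k f => next k f) k
  have hF : ∀ s, ∃ a, Tendsto (fun k => (F k).1 s) atTop (𝓝 a) := fun s =>
    cauchySeq_tendsto_of_complete (cauchySeq_of_le_geometric (1 / 2) (2 * D) (by norm_num)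
      fun k => hnext k (F k) s)
  choose f hf using hF
  refine ⟨f, measurable_of_tendsto_metrizable (fun k => (F k).2.1) (tendsto_pi_nhds.2 hf),
    fun s => ?_⟩
  choose a ha hd using fun k => (F k).2.2 s
  have hlim : Tendsto (fun k : ℕ => D * (1 / 2 : ℝ) ^ k) atTop (𝓝 0) := by
    simpa using (tendsto_pow_atTop_nhds_zero_of_lt_one (r := (1 / 2 : ℝ)) (by norm_num)
      (by norm_num)).const_mul D
  -- The nearby points of the fibre have the same limit as the approximations, and closedness of `G`
  -- puts that limit in the fibre.
  have hta : Tendsto a atTop (𝓝 (f s)) :=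
    (tendsto_iff_of_dist (squeeze_zero (fun _ => dist_nonneg) hd hlim)).2 (hf s)
  exact hG.mem_of_tendsto (tendsto_const_nhds.prodMk_nhds hta) (Eventually.of_forall ha)

end Selection

/-- A continuous function has a greedy policy. -/
theorem CompactMDP.exists_isGreedy {S A : Type*} [MetricSpace S] [CompactSpace S]
    [MeasurableSpace S] [OpensMeasurableSpace S] [MetricSpace A] [CompactSpace A]
    [MeasurableSpace A] [BorelSpace A] (M : CompactMDP S A) (hA : S → Nonempty A)
    {q : S × A → ℝ} (hq : Continuous q) : ∃ π : M.Policy, M.IsGreedy q π := by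
  have hG : IsClosed {x : S × A | ∀ a', q (x.1, a') ≤ q x} := by
    simp only [Set.ofPred_forall]
    exact isClosed_iInter fun a' => isClosed_le (by fun_prop) hq
  obtain ⟨f, hf, hfG⟩ := exists_measurable_selection hG fun s => by
    have := hA s
    obtain ⟨a, -, ha⟩ := isCompact_univ.exists_isMaxOn Set.univ_nonempty
      (hq.comp (Continuous.prodMk_right s)).continuousOn
    exact ⟨a, fun a' => ha (Set.mem_univ a')⟩
  refine ⟨⟨Kernel.deterministic f hf, inferInstance⟩, fun s => ?_⟩
  rw [Kernel.deterministic_apply]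
  exact Measure.dirac_apply_of_mem (hfG s)

/-! ### Global convergence -/

theorem mainTheorem1 {S A : Type*} [MetricSpace S] [CompactSpace S] [MeasurableSpace S]
    [OpensMeasurableSpace S] [MetricSpace A] [CompactSpace A] [MeasurableSpace A] [BorelSpace A]
    (M : CompactMDP S A) (π : ℕ → M.DensityPolicy)
    (hpos : ∀ s a, 0 < (π 0).dens s a)
    (hcont : ∀ s, Continuous fun a => (π 0).dens s a)
    (hB : ∀ n, π (n + 1) = M.B (π n)) :
    ∃ (VL : S → ℝ) (QL : S × A → ℝ),
      (∀ s, Tendsto (fun n => M.V (π n).toPolicy s) atTop (𝓝 (VL s))) ∧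
      (∀ x, Tendsto (fun n => M.Q (π n).toPolicy x) atTop (𝓝 (QL x))) ∧
      M.IsOptimalStateValue VL ∧
      M.IsOptimalActionValue QL ∧
      (∃ πL : M.Policy, M.IsGreedy QL πL) ∧
      ∀ πL : M.Policy, M.IsGreedy QL πL →
        (∀ s, TendstoWeaklyRel (CompactMDP.argmaxSet QL s)
          (fun n => (π n).toPolicy.law s) (πL.law s)) ∧
        M.IsOptimalPolicy πL ∧ M.V πL = VL ∧ M.Q πL = QL := by
  obtain ⟨v, hv⟩ := CompactMDP.exists_tendsto_V hB
  have hopt := CompactMDP.isOptimalPair_limit hB hv hpos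
  obtain ⟨πG, hG⟩ := M.exists_isGreedy
    -- `A` is known to be nonempty only once a state is given, because it then carries a probability
    -- measure.
    (fun s => nonempty_of_isProbabilityMeasure ((π 0).toPolicy.ker s))
    (CompactMDP.continuous_lookahead_limit hv)
  refine ⟨v, M.lookahead v, hv, CompactMDP.tendsto_Q hv, hopt.isOptimalStateValue hG,
    hopt.isOptimalActionValue, ⟨πG, hG⟩, fun πL hL => ⟨fun s => ?_, ?_, hopt.V_eq hL,
    hopt.Q_eq hL⟩⟩
  · refine tendstoWeaklyRel_of_tendsto_zero
      ((mem_ae_iff_prob_eq_one (hopt.measurableSet_argmaxSet s)).2 (hL s)) fun K hK hKF => ?_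
    refine CompactMDP.tendsto_real_zero hB hv s hK.isCompact fun a ha => ?_
    exact lt_of_le_of_ne ((hopt.isLUB s).1 ⟨a, rfl⟩) fun h =>
      Set.disjoint_left.1 hKF ha (hopt.mem_argmaxSet.2 h)
  · rw [CompactMDP.IsOptimalPolicy, hopt.Q_eq hL]
    exact hopt.isOptimalActionValue
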